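/- For an integer $n\ge 1$ let $\mathcal{P}_n$ be the set of positive definite complex $n\times n$ matrices and $\mathcal{I}_n$ the set of invertible complex $n\times n$ matrices. For $r,s\in\mathbb{R}$, $A,M\in\mathcal{P}_n$ and $K\in\mathcal{I}_n$ put \[ \Lambda_{r,s}(A)[K,M]=\operatorname{tr}\left[(K^*A^rMA^rK)^s\right]. \] Fix real numbers $r\neq 0$ and $s>0$ and an integer $n\ge 2$. Then: (i) the function $\mathcal{P}_n\ni A\mapsto\Lambda_{r,s}(A)[K,M]$ is convex for all $K\in\mathcal{I}_n$ and all $M\in\mathcal{P}_n$ if and only if $r=1$ and $s\ge \tfrac12$; (ii) it is not the case that the function $\mathcal{P}_n\ni A\mapsto\Lambda_{r,s}(A)[K,M]$ is concave for all $K\in\mathcal{I}_n$ and all $M\in\mathcal{P}_n$; that is, there exist $K\in\mathcal{I}_n$ and $M\in\mathcal{P}_n$ for which it is not concave. -/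

import Mathlib

open scoped Matrix MatrixOrder ComplexOrder

/-- `Λ_{r,s}(A)[K, M] = tr [(Kᴴ A^r M A^r K)^s]`, the real powers being those of the functional
calculus for positive matrices. For positive definite `A`, `M` the trace is a real number
(see `traceLambda_im`), and `.re` reads it as an element of `ℝ`. -/
noncomputable def traceLambda {n : ℕ} (r s : ℝ) (K M A : Matrix (Fin n) (Fin n) ℂ) : ℝ :=
  (Matrix.trace ((Kᴴ * A ^ r * M * A ^ r * K) ^ s)).re

/-- The trace in the definition of `traceLambda` is always real. -/
theorem traceLambda_im {n : ℕ} (r s : ℝ) (K M A : Matrix (Fin n) (Fin n) ℂ) :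
    ((traceLambda r s K M A : ℝ) : ℂ) = Matrix.trace ((Kᴴ * A ^ r * M * A ^ r * K) ^ s) := by
  have h : (0 : Matrix (Fin n) (Fin n) ℂ) ≤ (Kᴴ * A ^ r * M * A ^ r * K) ^ s :=
    CFC.rpow_nonneg
  have h2 := (Matrix.nonneg_iff_posSemidef.mp h).trace_nonneg
  exact (Complex.eq_re_of_ofReal_le h2).symm

/-!
For `r = 1` write `M = Nᴴ N`. Then `Λ_{1,s}(A)[K, M] = tr |N A K|^(2s)`, the `2s`-th power of a
Schatten norm of a matrix linear in `A`, which is convex when `2s ≥ 1`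
(`convexOn_traceLambda_one`). The proof of this convexity compares diagonals with singular values:
in any pair of orthonormal bases, the `ℓ^p` sum of the diagonal of `X` is at most that of the
singular values of `X` (`sum_norm_diag_rpow_le`), with equality in the singular bases.

For the converse, convexity (or concavity) for all invertible `K` and positive definite `M` extends
by continuity to all `K` and all positive semidefinite `M`
(`convexOn_traceLambda_of_posSemidef`, `concaveOn_traceLambda_of_posSemidef`). For rank-one `K` and
`M` the function becomes `A ↦ |⟨w, A^r v⟩|^(2s)` (`traceLambda_vecMulVec`), where `w = e_i - m e_j`
and `v = e_i + m e_j` suffice. This function is nonnegative and has zeros, which gives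
obstructions that hardly depend on `s`:

* a nonnegative concave function on an open convex set vanishes identically as soon as it has a
  zero, so concavity always fails (`not_concaveOn_abs_sub_rpow`);
* on diagonal matrices the function is `|a^r - m^2 b^r|^(2s)`; near a zero with `b` small its growth
  excludes `r < 0` (`nonneg_of_convexOn_abs_sub_rpow`), and for `r = 1` its growth at a zero excludes
  `s < 1/2` (`half_le_of_convexOn_abs_sub`);
* the zero set of a nonnegative convex function is convex. Two non-commuting zeros that are mirror
  images of each other have a diagonal midpoint, and this midpoint is a zero for all choices of the
  eigenvalues only if `r = 1` (`eq_one_of_convexOn_pencil`).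
-/

/-! ### Real powers along star homomorphisms from function algebras -/

/-- On a finite product `ι → ℝ` every function is interpolated by a polynomial, so a star
homomorphism out of it turns the functional calculus into entrywise application. -/
theorem cfc_starAlgHom_pi {ι A : Type*} [Finite ι] [Ring A] [StarRing A] [TopologicalSpace A]
    [Algebra ℝ A] [ContinuousFunctionalCalculus ℝ A IsSelfAdjoint]
    (φ : (ι → ℝ) →⋆ₐ[ℝ] A) (f : ℝ → ℝ) (d : ι → ℝ) :
    cfc f (φ d) = φ (f ∘ d) := by
  classical
  have := Fintype.ofFinite ι
  have hsa : IsSelfAdjoint (φ d) := by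
    rw [IsSelfAdjoint, ← map_star]; congr 1
  set q := Lagrange.interpolate (Finset.univ.image d) id f with hq
  have hqd : ∀ i, q.eval (d i) = f (d i) := fun i =>
    Lagrange.eval_interpolate_at_node f (v := id) Function.injective_id.injOn
      (Finset.mem_image_of_mem d (Finset.mem_univ i))
  have hspec : (spectrum ℝ (φ d)).EqOn f q.eval := by
    intro x hx
    have hx' : x ∈ spectrum ℝ d := AlgHom.spectrum_apply_subset φ.toAlgHom d hx
    rw [Pi.spectrum_eq] at hx'
    simp only [Set.mem_iUnion] at hx'
    obtain ⟨i, hi⟩ := hx'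
    have hxi : x = d i := by
      by_contra hne
      exact hi ((sub_ne_zero.mpr hne).isUnit)
    subst hxi
    exact (hqd i).symm
  rw [cfc_congr hspec, cfc_polynomial q _ hsa]
  have h1 := Polynomial.aeval_algHom_apply φ.toAlgHom d q
  have h2 : Polynomial.aeval d q = f ∘ d := by
    funext i
    rw [Function.comp_apply, ← hqd i, Polynomial.aeval_pi_apply]
    exact Polynomial.aeval_def _ _
  rw [h2] at h1
  exact h1

section

variable {ι n : Type*} [Fintype n] [DecidableEq n]

theorem starAlgHom_pi_nonneg (φ : (ι → ℝ) →⋆ₐ[ℝ] Matrix n n ℂ)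
    {d : ι → ℝ} (hd : ∀ i, 0 ≤ d i) : 0 ≤ φ d := by
  have h : d = star (fun i => √(d i)) * fun i => √(d i) := by
    funext i
    simp [Real.mul_self_sqrt (hd i)]
  rw [h, map_mul, map_star]
  exact star_mul_self_nonneg _

theorem starAlgHom_pi_posDef (φ : (ι → ℝ) →⋆ₐ[ℝ] Matrix n n ℂ)
    {d : ι → ℝ} (hd : ∀ i, 0 < d i) : (φ d).PosDef := by
  have h0 := Matrix.nonneg_iff_posSemidef.mp (starAlgHom_pi_nonneg φ fun i => (hd i).le)
  rw [h0.posDef_iff_isUnit]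
  exact (Pi.isUnit_iff.mpr fun i => (hd i).ne'.isUnit).map φ

/-- No condition on the sign of `y` is needed when some `d i` vanish: the spectrum is finite, so the
functional calculus applies to `x ↦ x ^ y`, with the convention of `Real.rpow` at `0`. -/
theorem rpow_starAlgHom_pi [Finite ι] (φ : (ι → ℝ) →⋆ₐ[ℝ] Matrix n n ℂ)
    {d : ι → ℝ} (hd : ∀ i, 0 ≤ d i) (y : ℝ) :
    (φ d) ^ y = φ (fun i => d i ^ y) := by
  rw [CFC.rpow_eq_cfc_real (starAlgHom_pi_nonneg φ hd), cfc_starAlgHom_pi]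
  rfl

/-- Conjugation by a unitary matrix, restricted to real diagonal matrices:
`d ↦ V * diagonal d * Vᴴ`. -/
noncomputable def conjDiagonal (V : Matrix.unitaryGroup n ℂ) : (n → ℝ) →⋆ₐ[ℝ] Matrix n n ℂ where
  toFun d := (V : Matrix n n ℂ) * Matrix.diagonal (fun i => (d i : ℂ)) * (V : Matrix n n ℂ)ᴴ
  map_one' := by
    have h : (V : Matrix n n ℂ) * (V : Matrix n n ℂ)ᴴ = 1 := Unitary.coe_mul_star_self V
    simpa using h
  map_mul' a b := by
    have h : (V : Matrix n n ℂ)ᴴ * (V : Matrix n n ℂ) = 1 := Unitary.coe_star_mul_self V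
    calc _ = (V : Matrix n n ℂ) * (Matrix.diagonal (fun i => (a i : ℂ)) *
          Matrix.diagonal (fun i => (b i : ℂ))) * (V : Matrix n n ℂ)ᴴ := by
            simp [Matrix.diagonal_mul_diagonal]
      _ = (V : Matrix n n ℂ) * (Matrix.diagonal (fun i => (a i : ℂ)) *
          ((V : Matrix n n ℂ)ᴴ * (V : Matrix n n ℂ)) *
          Matrix.diagonal (fun i => (b i : ℂ))) * (V : Matrix n n ℂ)ᴴ := by
            rw [h, mul_one]
      _ = _ := by simp only [mul_assoc]
  map_zero' := by simp
  map_add' a b := by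
    simp [← Matrix.diagonal_add, mul_add, add_mul]
  commutes' c := by
    have h : (V : Matrix n n ℂ) * (V : Matrix n n ℂ)ᴴ = 1 := Unitary.coe_mul_star_self V
    have h2 : Matrix.diagonal (fun i : n => (((algebraMap ℝ (n → ℝ)) c i : ℝ) : ℂ))
        = c • (1 : Matrix n n ℂ) := by
      ext i j
      by_cases hij : i = j <;> simp [hij]
    rw [h2, mul_smul_comm, mul_one, smul_mul_assoc, h, Algebra.algebraMap_eq_smul_one]
  map_star' a := by
    rw [Matrix.star_eq_conjTranspose, Matrix.conjTranspose_mul, Matrix.conjTranspose_mul,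
      Matrix.conjTranspose_conjTranspose, Matrix.diagonal_conjTranspose, mul_assoc]
    congr
    funext i
    simp

theorem conjDiagonal_apply (V : Matrix.unitaryGroup n ℂ) (d : n → ℝ) :
    conjDiagonal V d =
      (V : Matrix n n ℂ) * Matrix.diagonal (fun i => (d i : ℂ)) * (V : Matrix n n ℂ)ᴴ := rfl

theorem trace_conjDiagonal (V : Matrix.unitaryGroup n ℂ) (d : n → ℝ) :
    (conjDiagonal V d).trace = ((∑ i, d i : ℝ) : ℂ) := by
  have h : (V : Matrix n n ℂ)ᴴ * (V : Matrix n n ℂ) = 1 := Unitary.coe_star_mul_self V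
  rw [conjDiagonal_apply, Matrix.trace_mul_comm, ← mul_assoc, h, one_mul, Matrix.trace_diagonal]
  simp

/-! ### Singular values and convexity of `X ↦ tr |X|^p` -/

/-- Only invertible `X` are needed, so that the left factor is `X V Σ⁻¹`, with `V` diagonalizing
`Xᴴ X`. -/
theorem exists_singular_value_decomposition {X : Matrix n n ℂ} (hX : IsUnit X) :
    ∃ (U V : Matrix.unitaryGroup n ℂ) (σ : n → ℝ), (∀ i, 0 < σ i) ∧
      X = (U : Matrix n n ℂ) * Matrix.diagonal (fun i => (σ i : ℂ)) * (V : Matrix n n ℂ)ᴴ := by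
  have hG : (Xᴴ * X).PosDef :=
    (Matrix.posSemidef_conjTranspose_mul_self X).posDef_iff_isUnit.mpr
      (hX.star.mul hX)
  set V := hG.isHermitian.eigenvectorUnitary with hV
  set l := hG.isHermitian.eigenvalues with hl
  have hlpos : ∀ i, 0 < l i := hG.eigenvalues_pos
  have hspec : Xᴴ * X = (V : Matrix n n ℂ) * Matrix.diagonal (fun i => (l i : ℂ)) *
      (V : Matrix n n ℂ)ᴴ := hG.isHermitian.spectral_theorem
  have hVV : (V : Matrix n n ℂ)ᴴ * (V : Matrix n n ℂ) = 1 := Unitary.coe_star_mul_self V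
  have hVV' : (V : Matrix n n ℂ) * (V : Matrix n n ℂ)ᴴ = 1 := Unitary.coe_mul_star_self V
  set E : Matrix n n ℂ := Matrix.diagonal (fun i => (((√(l i))⁻¹ : ℝ) : ℂ)) with hE
  have hEE : Eᴴ = E := by
    rw [hE, Matrix.diagonal_conjTranspose]; congr; funext i; simp
  have hElE : E * Matrix.diagonal (fun i => (l i : ℂ)) * E = 1 := by
    rw [hE, Matrix.diagonal_mul_diagonal, Matrix.diagonal_mul_diagonal, ← Matrix.diagonal_one]
    congr; funext i
    norm_cast
    have := Real.mul_self_sqrt (hlpos i).le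
    have h0 := (Real.sqrt_pos.mpr (hlpos i)).ne'
    field_simp
    nlinarith
  have hU : X * V * E ∈ Matrix.unitaryGroup n ℂ := by
    rw [Matrix.mem_unitaryGroup_iff']
    rw [Matrix.star_eq_conjTranspose, Matrix.conjTranspose_mul, Matrix.conjTranspose_mul, hEE]
    calc E * ((V : Matrix n n ℂ)ᴴ * Xᴴ) * (X * V * E)
        = E * ((V : Matrix n n ℂ)ᴴ * (Xᴴ * X) * V) * E := by simp only [mul_assoc]
      _ = E * (((V : Matrix n n ℂ)ᴴ * V) * Matrix.diagonal (fun i => (l i : ℂ)) *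
            ((V : Matrix n n ℂ)ᴴ * V)) * E := by rw [hspec]; simp only [mul_assoc]
      _ = 1 := by rw [hVV, one_mul, mul_one, hElE]
  refine ⟨⟨_, hU⟩, V, fun i => √(l i), fun i => Real.sqrt_pos.mpr (hlpos i), ?_⟩
  have hED : E * Matrix.diagonal (fun i => ((√(l i) : ℝ) : ℂ)) = 1 := by
    rw [hE, Matrix.diagonal_mul_diagonal, ← Matrix.diagonal_one]
    congr; funext i
    have h0 := (Real.sqrt_pos.mpr (hlpos i)).ne'
    norm_cast
    exact inv_mul_cancel₀ h0
  rw [mul_assoc (X * (V : Matrix n n ℂ)), hED, mul_one, mul_assoc, hVV', mul_one]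

theorem trace_rpow_of_singular_value_decomposition {X : Matrix n n ℂ}
    {U V : Matrix.unitaryGroup n ℂ} {σ : n → ℝ} (hσ : ∀ i, 0 < σ i)
    (hX : X = (U : Matrix n n ℂ) * Matrix.diagonal (fun i => (σ i : ℂ)) * (V : Matrix n n ℂ)ᴴ)
    (s : ℝ) : (((Xᴴ * X) ^ s).trace).re = ∑ i, σ i ^ (2 * s) := by
  have hUU : (U : Matrix n n ℂ)ᴴ * (U : Matrix n n ℂ) = 1 := Unitary.coe_star_mul_self U
  have h : Xᴴ * X = conjDiagonal V (fun i => σ i ^ 2) := by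
    rw [hX, Matrix.conjTranspose_mul, Matrix.conjTranspose_mul,
      Matrix.conjTranspose_conjTranspose, Matrix.diagonal_conjTranspose, conjDiagonal_apply]
    calc _ = (V : Matrix n n ℂ) * (Matrix.diagonal (star fun i => (σ i : ℂ)) *
          ((U : Matrix n n ℂ)ᴴ * U) * Matrix.diagonal (fun i => (σ i : ℂ))) *
          (V : Matrix n n ℂ)ᴴ := by simp only [mul_assoc]
      _ = _ := by
        rw [hUU, mul_one, Matrix.diagonal_mul_diagonal]
        congr; funext i; simp [sq]
  rw [h, rpow_starAlgHom_pi _ (fun i => by positivity), trace_conjDiagonal, Complex.ofReal_re]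
  refine Finset.sum_congr rfl fun i _ => ?_
  rw [← Real.rpow_natCast, ← Real.rpow_mul (hσ i).le]
  norm_cast

theorem sum_norm_sq_row_unitaryGroup (W : Matrix.unitaryGroup n ℂ) (i : n) :
    ∑ j, ‖(W : Matrix n n ℂ) i j‖ ^ 2 = 1 := by
  have hW : (W : Matrix n n ℂ) * (W : Matrix n n ℂ)ᴴ = 1 := Unitary.coe_mul_star_self W
  have h := congrFun (congrFun hW i) i
  rw [Matrix.mul_apply, Matrix.one_apply_eq] at h
  have h2 : ((∑ j, ‖(W : Matrix n n ℂ) i j‖ ^ 2 : ℝ) : ℂ) = 1 := by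
    rw [← h]
    push_cast
    refine Finset.sum_congr rfl fun j _ => ?_
    rw [Matrix.conjTranspose_apply, Complex.star_def, Complex.mul_conj']
  exact_mod_cast h2

theorem sum_norm_sq_col_unitaryGroup (W : Matrix.unitaryGroup n ℂ) (j : n) :
    ∑ i, ‖(W : Matrix n n ℂ) i j‖ ^ 2 = 1 := by
  simpa using sum_norm_sq_row_unitaryGroup (star W) j

/-- For `p = 2s ≥ 1`, no pair of orthonormal bases gives `X` a diagonal with a larger `ℓ^p` sum
than the singular values of `X`: the diagonal is dominated by a doubly stochastic average of the
singular values, and Jensen's inequality applies. -/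
theorem sum_norm_diag_rpow_le {X : Matrix n n ℂ} (hX : IsUnit X)
    (U V : Matrix.unitaryGroup n ℂ) {s : ℝ} (hs : 1 / 2 ≤ s) :
    ∑ i, ‖((U : Matrix n n ℂ)ᴴ * X * (V : Matrix n n ℂ)) i i‖ ^ (2 * s) ≤
      (((Xᴴ * X) ^ s).trace).re := by
  obtain ⟨A, B, σ, hσ, hXe⟩ := exists_singular_value_decomposition hX
  rw [trace_rpow_of_singular_value_decomposition hσ hXe]
  set P : Matrix.unitaryGroup n ℂ := star U * A with hP
  set Q : Matrix.unitaryGroup n ℂ := star V * B with hQ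
  set S : n → n → ℝ := fun i j =>
    (‖(P : Matrix n n ℂ) i j‖ ^ 2 + ‖(Q : Matrix n n ℂ) i j‖ ^ 2) / 2 with hS
  have hS0 : ∀ i j, 0 ≤ S i j := fun i j => by positivity
  have hSrow : ∀ i, ∑ j, S i j = 1 := fun i => by
    simp only [hS, ← Finset.sum_div, Finset.sum_add_distrib, sum_norm_sq_row_unitaryGroup]
    norm_num
  have hScol : ∀ j, ∑ i, S i j = 1 := fun j => by
    simp only [hS, ← Finset.sum_div, Finset.sum_add_distrib, sum_norm_sq_col_unitaryGroup]
    norm_num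
  have hdiag : ∀ i, ‖((U : Matrix n n ℂ)ᴴ * X * (V : Matrix n n ℂ)) i i‖ ≤ ∑ j, S i j * σ j := by
    intro i
    have h1 : (U : Matrix n n ℂ)ᴴ * X * (V : Matrix n n ℂ) =
        (P : Matrix n n ℂ) * Matrix.diagonal (fun i => (σ i : ℂ)) * (Q : Matrix n n ℂ)ᴴ := by
      rw [hXe, hP, hQ]
      simp [Matrix.star_eq_conjTranspose, mul_assoc]
    rw [h1, Matrix.mul_apply]
    refine (norm_sum_le _ _).trans (Finset.sum_le_sum fun j _ => ?_)
    rw [Matrix.mul_diagonal, Matrix.conjTranspose_apply, norm_mul, norm_mul, norm_star,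
      Complex.norm_real, Real.norm_of_nonneg (hσ j).le]
    simp only [hS]
    -- the arithmetic-geometric mean inequality for the two unitary entries
    nlinarith [mul_nonneg (hσ j).le
      (sq_nonneg (‖(P : Matrix n n ℂ) i j‖ - ‖(Q : Matrix n n ℂ) i j‖))]
  have hconv : ConvexOn ℝ (Set.Ici 0) fun x : ℝ => x ^ (2 * s) := convexOn_rpow (by linarith)
  calc ∑ i, ‖((U : Matrix n n ℂ)ᴴ * X * (V : Matrix n n ℂ)) i i‖ ^ (2 * s)
      ≤ ∑ i, ∑ j, S i j * σ j ^ (2 * s) := by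
        refine Finset.sum_le_sum fun i _ => ?_
        refine (Real.rpow_le_rpow (norm_nonneg _) (hdiag i) (by linarith)).trans ?_
        exact hconv.map_sum_le (fun j _ => hS0 i j) (hSrow i) fun j _ => (hσ j).le
    _ = ∑ j, σ j ^ (2 * s) := by
        rw [Finset.sum_comm]
        simp only [← Finset.sum_mul, hScol, one_mul]

/-- Convexity of `X ↦ tr |X|^(2s)` along segments with invertible end points and an invertible
inner point. In the singular bases of the inner point its diagonal consists of the singular values,
and the diagonals of the end points are controlled by `sum_norm_diag_rpow_le`. -/
theorem trace_rpow_convex_combination_le {X Y : Matrix n n ℂ} (hX : IsUnit X) (hY : IsUnit Y)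
    {a b : ℝ} (ha : 0 ≤ a) (hb : 0 ≤ b) (hab : a + b = 1) (hZ : IsUnit (a • X + b • Y))
    {s : ℝ} (hs : 1 / 2 ≤ s) :
    ((((a • X + b • Y)ᴴ * (a • X + b • Y)) ^ s).trace).re ≤
      a * (((Xᴴ * X) ^ s).trace).re + b * (((Yᴴ * Y) ^ s).trace).re := by
  obtain ⟨U, V, σ, hσ, hZe⟩ := exists_singular_value_decomposition hZ
  have hUU : (U : Matrix n n ℂ)ᴴ * (U : Matrix n n ℂ) = 1 := Unitary.coe_star_mul_self U
  have hVV : (V : Matrix n n ℂ)ᴴ * (V : Matrix n n ℂ) = 1 := Unitary.coe_star_mul_self V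
  rw [trace_rpow_of_singular_value_decomposition hσ hZe]
  have hconv : ConvexOn ℝ (Set.Ici 0) fun x : ℝ => x ^ (2 * s) := convexOn_rpow (by linarith)
  set x : n → ℂ := fun i => ((U : Matrix n n ℂ)ᴴ * X * (V : Matrix n n ℂ)) i i with hx
  set y : n → ℂ := fun i => ((U : Matrix n n ℂ)ᴴ * Y * (V : Matrix n n ℂ)) i i with hy
  have hle : ∀ i, σ i ≤ a * ‖x i‖ + b * ‖y i‖ := by
    intro i
    have h1 : (U : Matrix n n ℂ)ᴴ * (a • X + b • Y) * (V : Matrix n n ℂ) =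
        Matrix.diagonal (fun i => (σ i : ℂ)) := by
      rw [hZe]
      calc _ = ((U : Matrix n n ℂ)ᴴ * U) * Matrix.diagonal (fun i => (σ i : ℂ)) *
            ((V : Matrix n n ℂ)ᴴ * V) := by simp only [mul_assoc]
        _ = _ := by rw [hUU, hVV, one_mul, mul_one]
    have h2 : (σ i : ℂ) = a • x i + b • y i := by
      have h3 := congrFun (congrFun h1 i) i
      rw [Matrix.diagonal_apply_eq] at h3
      rw [← h3, mul_add, add_mul, mul_smul_comm, smul_mul_assoc, mul_smul_comm, smul_mul_assoc]
      rfl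
    calc σ i = ‖(σ i : ℂ)‖ := by rw [Complex.norm_real, Real.norm_of_nonneg (hσ i).le]
      _ ≤ ‖a • x i‖ + ‖b • y i‖ := by rw [h2]; exact norm_add_le _ _
      _ = _ := by rw [norm_smul, norm_smul, Real.norm_of_nonneg ha, Real.norm_of_nonneg hb]
  calc ∑ i, σ i ^ (2 * s) ≤ ∑ i, (a * ‖x i‖ ^ (2 * s) + b * ‖y i‖ ^ (2 * s)) := by
        refine Finset.sum_le_sum fun i _ => ?_
        refine (Real.rpow_le_rpow (hσ i).le (hle i) (by linarith)).trans ?_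
        simpa using hconv.2 (Set.mem_Ici.mpr (norm_nonneg (x i)))
          (Set.mem_Ici.mpr (norm_nonneg (y i))) ha hb hab
    _ = a * ∑ i, ‖x i‖ ^ (2 * s) + b * ∑ i, ‖y i‖ ^ (2 * s) := by
        rw [Finset.sum_add_distrib, Finset.mul_sum, Finset.mul_sum]
    _ ≤ _ := by
        gcongr
        · exact sum_norm_diag_rpow_le hX U V hs
        · exact sum_norm_diag_rpow_le hY U V hs

end

/-- With `M = Nᴴ N` the argument of the power is `|N A K|²`, and `N A K` is linear in `A`. -/
theorem convexOn_traceLambda_one {n : ℕ} {K M : Matrix (Fin n) (Fin n) ℂ} (hK : IsUnit K)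
    (hM : M.PosDef) {s : ℝ} (hs : 1 / 2 ≤ s) :
    ConvexOn ℝ {A : Matrix (Fin n) (Fin n) ℂ | A.PosDef} (fun A => traceLambda 1 s K M A) := by
  have hset : Convex ℝ {A : Matrix (Fin n) (Fin n) ℂ | A.PosDef} := by
    intro A hA B hB a b ha hb hab
    rcases ha.eq_or_lt with rfl | ha
    · obtain rfl : b = 1 := by linarith
      simpa using hB
    · exact (Matrix.PosDef.smul hA ha).add_posSemidef (hB.posSemidef.smul hb)
  obtain ⟨N, hN⟩ := CStarAlgebra.nonneg_iff_eq_star_mul_self.mp hM.posSemidef.nonneg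
  have hNu : IsUnit N := by
    have h := hM.isUnit
    rw [hN, Matrix.isUnit_iff_isUnit_det, Matrix.det_mul] at h
    exact (Matrix.isUnit_iff_isUnit_det _).mpr (isUnit_of_mul_isUnit_right h)
  have hform : ∀ A : Matrix (Fin n) (Fin n) ℂ, A.PosDef →
      traceLambda 1 s K M A = ((((N * A * K)ᴴ * (N * A * K)) ^ s).trace).re := by
    intro A hA
    have h1 : A ^ (1 : ℝ) = A := CFC.rpow_one A hA.posSemidef.nonneg
    rw [traceLambda, h1, hN, Matrix.star_eq_conjTranspose]
    simp only [Matrix.conjTranspose_mul, hA.isHermitian.eq, mul_assoc]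
  refine ⟨hset, fun A hA B hB a b ha hb hab => ?_⟩
  have hC := hset hA hB ha hb hab
  have hu : ∀ C : Matrix (Fin n) (Fin n) ℂ, C.PosDef → IsUnit (N * C * K) :=
    fun C hC => (hNu.mul hC.isUnit).mul hK
  have hlin : N * (a • A + b • B) * K = a • (N * A * K) + b • (N * B * K) := by
    rw [mul_add, add_mul, mul_smul_comm, smul_mul_assoc, mul_smul_comm, smul_mul_assoc]
  have hZ := hu _ hC
  simp only [hform _ hC, hform A hA, hform B hB, smul_eq_mul]
  rw [hlin] at hZ ⊢
  exact trace_rpow_convex_combination_le (hu A hA) (hu B hB) ha hb hab hZ hs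

section

open Filter Topology

/-! ### Passage to singular `K` and `M` -/

section
open scoped Matrix.Norms.L2Operator

theorem continuousOn_rpow_matrix {n : Type*} [Fintype n] [DecidableEq n] {s : ℝ} (hs : 0 < s) :
    ContinuousOn (fun X : Matrix n n ℂ => X ^ s) {X | 0 ≤ X} :=
  ContinuousOn.cfc_nnreal_of_mem_nhdsSet (A := Matrix n n ℂ) (s := Set.univ)
    (fun x : NNReal => x ^ s) (a := fun X : Matrix n n ℂ => X) (t := {X | 0 ≤ X})
    Filter.univ_mem continuousOn_id (fun _ hx => hx)
    (NNReal.continuous_rpow_const hs.le).continuousOn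

end

theorem traceLambda_arg_nonneg {n : ℕ} (r : ℝ) (K A : Matrix (Fin n) (Fin n) ℂ)
    {M : Matrix (Fin n) (Fin n) ℂ} (hM : M.PosSemidef) : 0 ≤ Kᴴ * A ^ r * M * A ^ r * K := by
  have hA : (A ^ r)ᴴ = A ^ r :=
    (Matrix.nonneg_iff_posSemidef.mp (CFC.rpow_nonneg (a := A) (y := r))).isHermitian.eq
  have h := hM.conjTranspose_mul_mul_same (A ^ r * K)
  rw [Matrix.conjTranspose_mul, hA] at h
  simpa only [mul_assoc] using h.nonneg

theorem tendsto_traceLambda_add_smul_one {n : ℕ} (r : ℝ) {s : ℝ} (hs : 0 < s)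
    (K A : Matrix (Fin n) (Fin n) ℂ) {M : Matrix (Fin n) (Fin n) ℂ} (hM : M.PosSemidef) :
    Tendsto (fun ε : ℝ => traceLambda r s (K + ε • 1) (M + ε • 1) A) (𝓝[>] 0)
      (𝓝 (traceLambda r s K M A)) := by
  have hcont : Continuous fun ε : ℝ => (K + ε • (1 : Matrix (Fin n) (Fin n) ℂ))ᴴ * A ^ r *
      (M + ε • (1 : Matrix (Fin n) (Fin n) ℂ)) * A ^ r *
      (K + ε • (1 : Matrix (Fin n) (Fin n) ℂ)) := by
    fun_prop
  have h1 := hcont.tendsto 0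
  simp only [zero_smul, add_zero] at h1
  have h2 : Tendsto (fun ε : ℝ => (K + ε • (1 : Matrix (Fin n) (Fin n) ℂ))ᴴ * A ^ r *
      (M + ε • (1 : Matrix (Fin n) (Fin n) ℂ)) * A ^ r * (K + ε • (1 : Matrix (Fin n) (Fin n) ℂ)))
      (𝓝[>] 0) (𝓝[{X | 0 ≤ X}] (Kᴴ * A ^ r * M * A ^ r * K)) := by
    refine tendsto_nhdsWithin_iff.mpr ⟨h1.mono_left nhdsWithin_le_nhds, ?_⟩
    filter_upwards [self_mem_nhdsWithin] with ε hε
    exact traceLambda_arg_nonneg r _ A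
      (hM.add (Matrix.PosSemidef.one.smul (le_of_lt (Set.mem_Ioi.mp hε))))
  have h3 := (continuousOn_rpow_matrix (n := Fin n) hs _
    (traceLambda_arg_nonneg r K A hM)).tendsto.comp h2
  have h4 : Continuous fun X : Matrix (Fin n) (Fin n) ℂ => X.trace.re :=
    Complex.continuous_re.comp continuous_id.matrix_trace
  exact (h4.tendsto _).comp h3

theorem eventually_isUnit_add_smul_one {n : Type*} [Fintype n] [DecidableEq n]
    (K : Matrix n n ℂ) : ∀ᶠ ε : ℝ in 𝓝[>] 0, IsUnit (K + ε • (1 : Matrix n n ℂ)) := by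
  have hfin : ((fun x : ℝ => -x) '' spectrum ℝ K \ {0}).Finite :=
    ((Matrix.finite_real_spectrum (A := K)).image _).sdiff
  have h0 : ((fun x : ℝ => -x) '' spectrum ℝ K \ {0})ᶜ ∈ 𝓝 (0 : ℝ) :=
    hfin.isClosed.isOpen_compl.mem_nhds (by simp)
  filter_upwards [nhdsWithin_le_nhds h0, self_mem_nhdsWithin] with ε hε hpos
  have hns : -ε ∉ spectrum ℝ K := fun h =>
    hε ⟨⟨-ε, h, neg_neg ε⟩, (Set.mem_Ioi.mp hpos).ne'⟩
  have hu := spectrum.notMem_iff.mp hns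
  rw [Algebra.algebraMap_eq_smul_one] at hu
  have h := hu.neg
  rwa [neg_sub, neg_smul, sub_neg_eq_add] at h

theorem eventually_posDef_add_smul_one {n : Type*} [Fintype n] [DecidableEq n]
    {M : Matrix n n ℂ} (hM : M.PosSemidef) :
    ∀ᶠ ε : ℝ in 𝓝[>] 0, (M + ε • (1 : Matrix n n ℂ)).PosDef := by
  filter_upwards [self_mem_nhdsWithin] with ε hε
  exact Matrix.PosDef.posSemidef_add hM (Matrix.PosDef.one.smul (Set.mem_Ioi.mp hε))

/-- Convexity for all invertible `K` and positive definite `M` survives the limit `K + ε → K`,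
`M + ε → M`, so it may be tested on singular `K` and `M`. -/
theorem convexOn_traceLambda_of_posSemidef {n : ℕ} {r s : ℝ} (hs : 0 < s)
    (h : ∀ K M : Matrix (Fin n) (Fin n) ℂ, IsUnit K → M.PosDef →
      ConvexOn ℝ {A : Matrix (Fin n) (Fin n) ℂ | A.PosDef} (fun A => traceLambda r s K M A))
    (K : Matrix (Fin n) (Fin n) ℂ) {M : Matrix (Fin n) (Fin n) ℂ} (hM : M.PosSemidef) :
    ConvexOn ℝ {A : Matrix (Fin n) (Fin n) ℂ | A.PosDef} (fun A => traceLambda r s K M A) := by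
  refine ⟨(h 1 1 isUnit_one Matrix.PosDef.one).1, fun A hA B hB a b ha hb hab => ?_⟩
  refine le_of_tendsto_of_tendsto (tendsto_traceLambda_add_smul_one r hs K _ hM)
    (((tendsto_traceLambda_add_smul_one r hs K A hM).const_smul a).add
      ((tendsto_traceLambda_add_smul_one r hs K B hM).const_smul b)) ?_
  filter_upwards [eventually_isUnit_add_smul_one K, eventually_posDef_add_smul_one hM] with ε h1 h2
  exact (h _ _ h1 h2).2 hA hB ha hb hab

theorem concaveOn_traceLambda_of_posSemidef {n : ℕ} {r s : ℝ} (hs : 0 < s)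
    (h : ∀ K M : Matrix (Fin n) (Fin n) ℂ, IsUnit K → M.PosDef →
      ConcaveOn ℝ {A : Matrix (Fin n) (Fin n) ℂ | A.PosDef} (fun A => traceLambda r s K M A))
    (K : Matrix (Fin n) (Fin n) ℂ) {M : Matrix (Fin n) (Fin n) ℂ} (hM : M.PosSemidef) :
    ConcaveOn ℝ {A : Matrix (Fin n) (Fin n) ℂ | A.PosDef} (fun A => traceLambda r s K M A) := by
  refine ⟨(h 1 1 isUnit_one Matrix.PosDef.one).1, fun A hA B hB a b ha hb hab => ?_⟩
  refine le_of_tendsto_of_tendsto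
    (((tendsto_traceLambda_add_smul_one r hs K A hM).const_smul a).add
      ((tendsto_traceLambda_add_smul_one r hs K B hM).const_smul b))
    (tendsto_traceLambda_add_smul_one r hs K _ hM) ?_
  filter_upwards [eventually_isUnit_add_smul_one K, eventually_posDef_add_smul_one hM] with ε h1 h2
  exact (h _ _ h1 h2).2 hA hB ha hb hab

/-! ### Rank-one `K` and `M` -/

/-- For `K = w e_iᵀ` and `M = v vᴴ` the argument of the power is `|wᴴ A^r v|²` times the `i`-th
diagonal matrix unit. -/
theorem traceLambda_vecMulVec {n : ℕ} (r : ℝ) {s : ℝ} (hs : 0 < s)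
    (A : Matrix (Fin n) (Fin n) ℂ) (v w : Fin n → ℂ) (i : Fin n) :
    traceLambda r s (Matrix.vecMulVec w (Pi.single i 1)) (Matrix.vecMulVec v (star v)) A =
      ‖star w ⬝ᵥ (A ^ r *ᵥ v)‖ ^ (2 * s) := by
  have hA : (A ^ r)ᴴ = A ^ r :=
    (Matrix.nonneg_iff_posSemidef.mp (CFC.rpow_nonneg (a := A) (y := r))).isHermitian.eq
  set z := star w ⬝ᵥ (A ^ r *ᵥ v) with hz
  have hz' : star v ⬝ᵥ (A ^ r *ᵥ w) = star z := by
    rw [hz, Matrix.star_dotProduct, Matrix.star_mulVec, hA, ← Matrix.dotProduct_mulVec]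
  have hX : (Matrix.vecMulVec w (Pi.single i 1))ᴴ * A ^ r * Matrix.vecMulVec v (star v) * A ^ r *
      Matrix.vecMulVec w (Pi.single i 1) = conjDiagonal 1 (Pi.single i (‖z‖ ^ 2)) := by
    rw [Matrix.conjTranspose_vecMulVec]
    simp only [mul_assoc, Matrix.mul_vecMulVec, Matrix.vecMulVec_mulVec, hz', ← hz]
    ext a b
    rw [conjDiagonal_apply, Matrix.vecMulVec_apply]
    have hzz : z * star z = (‖z‖ : ℂ) ^ 2 := by rw [Complex.star_def, Complex.mul_conj']
    by_cases ha : a = i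
    · subst ha
      by_cases hb : a = b
      · subst hb
        simpa using hzz
      · simp [hb, Ne.symm hb]
    · by_cases hb : a = b
      · subst hb
        simp [ha]
      · simp [ha]
  rw [traceLambda, hX, rpow_starAlgHom_pi, trace_conjDiagonal, Complex.ofReal_re,
    Finset.sum_eq_single i]
  · rw [Pi.single_eq_same, ← Real.rpow_natCast, ← Real.rpow_mul (norm_nonneg _)]
    norm_cast
  · intro k _ hk
    rw [Pi.single_eq_of_ne hk, Real.zero_rpow hs.ne']
  · simp
  · intro k
    by_cases hk : k = i
    · subst hk; simp
    · rw [Pi.single_eq_of_ne hk]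

/-- The sesquilinear form `wᴴ B v` of `B` at `w = e_i - m e_j` and `v = e_i + m e_j`, written out in
the entries of `B`. On real symmetric `B` the off-diagonal terms cancel. -/
def pencil {n : Type*} (i j : n) (m : ℝ) (B : Matrix n n ℂ) : ℂ :=
  B i i + m * B i j - m * B j i - m ^ 2 * B j j

theorem exists_posSemidef_traceLambda_eq {n : ℕ} (r : ℝ) {s : ℝ} (hs : 0 < s) (i j : Fin n)
    (m : ℝ) : ∃ K M : Matrix (Fin n) (Fin n) ℂ, M.PosSemidef ∧
      ∀ A, traceLambda r s K M A = ‖pencil i j m (A ^ r)‖ ^ (2 * s) := by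
  set v : Fin n → ℂ := Pi.single i 1 + Pi.single j (m : ℂ) with hv
  set w : Fin n → ℂ := Pi.single i 1 - Pi.single j (m : ℂ) with hw
  refine ⟨Matrix.vecMulVec w (Pi.single i 1), Matrix.vecMulVec v (star v),
    Matrix.posSemidef_vecMulVec_self_star v, fun A => ?_⟩
  rw [traceLambda_vecMulVec r hs]
  have hform : ∀ B : Matrix (Fin n) (Fin n) ℂ, star w ⬝ᵥ (B *ᵥ v) = pencil i j m B := by
    intro B
    rw [hv, hw, Matrix.mulVec_add, star_sub, ← Pi.single_star, ← Pi.single_star, sub_dotProduct]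
    simp [pencil]
    ring
  rw [hform]

/-! ### Commuting test matrices -/

theorem pencil_conjDiagonal_one_rpow {n : Type*} [Fintype n] [DecidableEq n] {i j : n}
    (hij : i ≠ j) (m r : ℝ) {d : n → ℝ} (hd : ∀ k, 0 ≤ d k) :
    pencil i j m ((conjDiagonal 1 d) ^ r) = ((d i ^ r - m ^ 2 * d j ^ r : ℝ) : ℂ) := by
  rw [rpow_starAlgHom_pi _ hd, conjDiagonal_apply]
  simp [pencil, Matrix.one_apply_ne hij, Matrix.one_apply_ne hij.symm]

theorem convex_setOf_pos {ι : Type*} : Convex ℝ {d : ι → ℝ | ∀ k, 0 < d k} := by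
  intro x hx y hy a b ha hb hab k
  exact convex_Ioi (0 : ℝ) (hx k) (hy k) ha hb hab

theorem update_one_mem_setOf_pos {ι : Type*} [DecidableEq ι] (i : ι) {t : ℝ} (ht : 0 < t) :
    Function.update (1 : ι → ℝ) i t ∈ {d : ι → ℝ | ∀ k, 0 < d k} := by
  intro k
  by_cases hk : k = i
  · subst hk; simpa using ht
  · simp [hk]

theorem norm_pencil_conjDiagonal_one_rpow {n : Type*} [Fintype n] [DecidableEq n] {i j : n}
    (hij : i ≠ j) (m r : ℝ) {d : n → ℝ} (hd : ∀ k, 0 < d k) :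
    ‖pencil i j m ((conjDiagonal 1 d) ^ r)‖ = |d i ^ r - m ^ 2 * d j ^ r| := by
  rw [pencil_conjDiagonal_one_rpow hij m r fun k => (hd k).le, Complex.norm_real, Real.norm_eq_abs]

theorem convexOn_abs_sub_rpow {n : ℕ} {r s : ℝ} {i j : Fin n} (hij : i ≠ j) (m : ℝ)
    (h : ConvexOn ℝ {A : Matrix (Fin n) (Fin n) ℂ | A.PosDef}
      (fun A => ‖pencil i j m (A ^ r)‖ ^ (2 * s))) :
    ConvexOn ℝ {d : Fin n → ℝ | ∀ k, 0 < d k}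
      (fun d => |d i ^ r - m ^ 2 * d j ^ r| ^ (2 * s)) := by
  refine ((h.comp_linearMap (conjDiagonal 1).toAlgHom.toLinearMap).subset
    (fun d hd => starAlgHom_pi_posDef (conjDiagonal 1) hd) convex_setOf_pos).congr fun d hd => ?_
  exact congrArg (· ^ (2 * s)) (norm_pencil_conjDiagonal_one_rpow hij m r hd)

theorem concaveOn_abs_sub_rpow {n : ℕ} {r s : ℝ} {i j : Fin n} (hij : i ≠ j) (m : ℝ)
    (h : ConcaveOn ℝ {A : Matrix (Fin n) (Fin n) ℂ | A.PosDef}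
      (fun A => ‖pencil i j m (A ^ r)‖ ^ (2 * s))) :
    ConcaveOn ℝ {d : Fin n → ℝ | ∀ k, 0 < d k}
      (fun d => |d i ^ r - m ^ 2 * d j ^ r| ^ (2 * s)) := by
  refine ((h.comp_linearMap (conjDiagonal 1).toAlgHom.toLinearMap).subset
    (fun d hd => starAlgHom_pi_posDef (conjDiagonal 1) hd) convex_setOf_pos).congr fun d hd => ?_
  exact congrArg (· ^ (2 * s)) (norm_pencil_conjDiagonal_one_rpow hij m r hd)

/-- A nonnegative concave function on an open convex set that vanishes somewhere vanishes
everywhere; this one vanishes at `1` only on the segment considered. -/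
theorem not_concaveOn_abs_sub_rpow {ι : Type*} [DecidableEq ι] {r s : ℝ} (hr : r ≠ 0) (hs : 0 < s)
    {i j : ι} (hij : i ≠ j) :
    ¬ ConcaveOn ℝ {d : ι → ℝ | ∀ k, 0 < d k} (fun d => |d i ^ r - d j ^ r| ^ (2 * s)) := by
  intro h
  have hpos := fun (t : ℝ) (ht : 0 < t) => update_one_mem_setOf_pos i ht
  have h1 := h.2 (hpos (1 / 2) (by norm_num)) (hpos (3 / 2) (by norm_num))
    (by norm_num : (0 : ℝ) ≤ 1 / 2) (by norm_num : (0 : ℝ) ≤ 1 / 2) (by norm_num)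
  simp only [Function.update_self, Function.update_of_ne hij.symm, Pi.add_apply, Pi.smul_apply,
    smul_eq_mul, Pi.one_apply] at h1
  norm_num at h1
  rw [Real.zero_rpow (by positivity)] at h1
  have h2 : (0 : ℝ) < |(3 / 2 : ℝ) ^ r - 1| ^ (2 * s) := by
    refine Real.rpow_pos_of_pos (abs_pos.mpr (sub_ne_zero.mpr fun h3 => hr ?_)) _
    rw [← Real.rpow_zero (3 / 2)] at h3
    exact (Real.rpow_right_inj (by norm_num) (by norm_num)).mp h3
  have h3 : (0 : ℝ) ≤ |(1 / 2 : ℝ) ^ r - 1| ^ (2 * s) := by positivity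
  linarith

/-- Let `r < 0` and let `m^2 = b^(-r)`, so that the function vanishes at `d_i = 1`, `d_j = b`. As
`b → 0`, the ratio of its value at the midpoint of this zero and `1` to its value at `1` tends to
`1`, whereas convexity bounds that ratio by `1 / 2`. -/
theorem nonneg_of_convexOn_abs_sub_rpow {ι : Type*} [DecidableEq ι] {r s : ℝ} (hs : 0 < s)
    {i j : ι} (hij : i ≠ j)
    (h : ∀ m : ℝ, ConvexOn ℝ {d : ι → ℝ | ∀ k, 0 < d k}
      (fun d => |d i ^ r - m ^ 2 * d j ^ r| ^ (2 * s))) : 0 ≤ r := by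
  by_contra! hr
  have hpos := fun (t : ℝ) (ht : 0 < t) => update_one_mem_setOf_pos j ht
  have key : ∀ b : ℝ, 0 < b →
      |1 - (b * (b / 2 + 1 / 2)⁻¹) ^ (-r)| ^ (2 * s) ≤ 1 / 2 * |1 - b ^ (-r)| ^ (2 * s) := by
    intro b hb
    have hm : (b ^ (-r / 2)) ^ 2 = b ^ (-r) := by
      rw [← Real.rpow_natCast, ← Real.rpow_mul hb.le]
      norm_num
    have h1 := (h (b ^ (-r / 2))).2 (hpos b hb) (hpos 1 one_pos)
      (by norm_num : (0 : ℝ) ≤ 1 / 2) (by norm_num : (0 : ℝ) ≤ 1 / 2) (by norm_num)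
    have hbr : b ^ (-r) * b ^ r = 1 := by rw [← Real.rpow_add hb]; simp
    have hc : b ^ (-r) * (b / 2 + 1 / 2) ^ r = (b * (b / 2 + 1 / 2)⁻¹) ^ (-r) := by
      rw [Real.mul_rpow hb.le (by positivity), Real.inv_rpow (by positivity),
        Real.rpow_neg (by positivity : (0 : ℝ) ≤ b / 2 + 1 / 2), inv_inv]
    have hmid : (1 / 2 : ℝ) * b + 1 / 2 = b / 2 + 1 / 2 := by ring
    simp only [hm, Function.update_self, Function.update_of_ne hij, Pi.add_apply, Pi.smul_apply,
      smul_eq_mul, Pi.one_apply, mul_one, Real.one_rpow, hbr, sub_self, abs_zero, hmid, hc,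
      Real.zero_rpow (by positivity : (2 * s) ≠ 0), mul_zero, zero_add] at h1
    norm_num at h1 ⊢
    exact h1
  have ht : Tendsto (fun b : ℝ => |1 - (b * (b / 2 + 1 / 2)⁻¹) ^ (-r)| ^ (2 * s)) (𝓝[>] 0)
      (𝓝 (|1 - ((0 : ℝ) * (0 / 2 + 1 / 2)⁻¹) ^ (-r)| ^ (2 * s))) := by
    refine Tendsto.mono_left (ContinuousAt.tendsto ?_) nhdsWithin_le_nhds
    refine ContinuousAt.rpow_const (ContinuousAt.abs (continuousAt_const.sub
      (ContinuousAt.rpow_const (continuousAt_id.mul (ContinuousAt.inv₀ (by fun_prop) (by norm_num)))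
        (Or.inr (by linarith))))) (Or.inr (by positivity))
  have ht' : Tendsto (fun b : ℝ => 1 / 2 * |1 - b ^ (-r)| ^ (2 * s)) (𝓝[>] 0)
      (𝓝 (1 / 2 * |1 - (0 : ℝ) ^ (-r)| ^ (2 * s))) := by
    refine Tendsto.mono_left (ContinuousAt.tendsto ?_) nhdsWithin_le_nhds
    refine continuousAt_const.mul (ContinuousAt.rpow_const (ContinuousAt.abs
      (continuousAt_const.sub (ContinuousAt.rpow_const continuousAt_id
        (Or.inr (by linarith))))) (Or.inr (by positivity)))
  have hle := le_of_tendsto_of_tendsto ht ht' (by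
    filter_upwards [self_mem_nhdsWithin] with b hb using key b hb)
  rw [zero_mul, Real.zero_rpow (by linarith), sub_zero, abs_one, Real.one_rpow] at hle
  norm_num at hle

/-- Convexity is tested at `d_i = 1, 2, 3` with `d_j = 1`, where it reads
`1 ≤ 2 ^ (2 * s) / 2`. -/
theorem half_le_of_convexOn_abs_sub {ι : Type*} [DecidableEq ι] {s : ℝ} (hs : 0 < s)
    {i j : ι} (hij : i ≠ j)
    (h : ConvexOn ℝ {d : ι → ℝ | ∀ k, 0 < d k} (fun d => |d i - d j| ^ (2 * s))) :
    1 / 2 ≤ s := by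
  have hpos := fun (t : ℝ) (ht : 0 < t) => update_one_mem_setOf_pos i ht
  have h1 := h.2 (hpos 1 one_pos) (hpos 3 (by norm_num))
    (by norm_num : (0 : ℝ) ≤ 1 / 2) (by norm_num : (0 : ℝ) ≤ 1 / 2) (by norm_num)
  simp only [Function.update_self, Function.update_of_ne hij.symm, Pi.add_apply, Pi.smul_apply,
    smul_eq_mul, Pi.one_apply] at h1
  norm_num at h1
  rw [Real.zero_rpow (by positivity)] at h1
  by_contra! hlt
  have h2 : (2 : ℝ) ^ (2 * s) < 2 ^ (1 : ℝ) :=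
    Real.rpow_lt_rpow_of_exponent_lt (by norm_num) (by linarith)
  rw [Real.rpow_one] at h2
  linarith

/-! ### A pair of non-commuting test matrices -/

/-- The star homomorphism `d ↦ d_0 P + d_1 (1 - P)` attached to a projection `P`. -/
noncomputable def projectionHom {n : Type*} [Fintype n] [DecidableEq n] (P : Matrix n n ℂ)
    (hP : IsStarProjection P) : (Fin 2 → ℝ) →⋆ₐ[ℝ] Matrix n n ℂ where
  toFun d := d 0 • P + d 1 • (1 - P)
  map_one' := by simp
  map_mul' a b := by
    have h1 : P * P = P := hP.isIdempotentElem
    have h2 : P * (1 - P) = 0 := by rw [mul_sub, h1, mul_one, sub_self]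
    have h3 : (1 - P) * P = 0 := by rw [sub_mul, h1, one_mul, sub_self]
    have h4 : (1 - P) * (1 - P) = 1 - P := by rw [mul_sub, h3, mul_one, sub_zero]
    simp only [Pi.mul_apply, mul_add, add_mul, smul_mul_assoc, mul_smul_comm, h1, h2, h3, h4,
      smul_zero, add_zero, zero_add, smul_smul]
    rw [mul_comm (a 0), mul_comm (a 1)]
  map_zero' := by simp
  map_add' a b := by simp only [Pi.add_apply, add_smul]; abel
  commutes' c := by
    simp only [Pi.algebraMap_apply, Algebra.algebraMap_self_apply, ← smul_add, add_sub_cancel]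
    exact (Algebra.algebraMap_eq_smul_one c).symm
  map_star' a := by
    have h : star P = P := hP.isSelfAdjoint
    simp [h]

theorem projectionHom_apply {n : Type*} [Fintype n] [DecidableEq n] (P : Matrix n n ℂ)
    (hP : IsStarProjection P) (d : Fin 2 → ℝ) :
    projectionHom P hP d = d 0 • P + d 1 • (1 - P) := rfl

theorem isStarProjection_vecMulVec {n : Type*} [Fintype n] [DecidableEq n] {i j : n}
    (hij : i ≠ j) {c t : ℝ} (h : c ^ 2 + t ^ 2 = 1) :
    IsStarProjection (Matrix.vecMulVec (Pi.single i (c : ℂ) + Pi.single j (t : ℂ))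
      (Pi.single i (c : ℂ) + Pi.single j (t : ℂ)) : Matrix n n ℂ) := by
  have hstar : star (Pi.single i (c : ℂ) + Pi.single j (t : ℂ) : n → ℂ) =
      Pi.single i (c : ℂ) + Pi.single j (t : ℂ) := by
    rw [star_add, ← Pi.single_star, ← Pi.single_star]
    simp
  have hdot : (Pi.single i (c : ℂ) + Pi.single j (t : ℂ) : n → ℂ) ⬝ᵥ
      (Pi.single i (c : ℂ) + Pi.single j (t : ℂ)) = 1 := by
    rw [add_dotProduct]
    simp [hij, hij.symm]
    exact_mod_cast (by nlinarith : c * c + t * t = 1)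
  constructor
  · rw [IsIdempotentElem, Matrix.vecMulVec_mul_vecMulVec, hdot, one_smul]
  · rw [IsSelfAdjoint, Matrix.star_eq_conjTranspose, Matrix.conjTranspose_vecMulVec, hstar]

theorem pencil_projectionHom_rpow {n : Type*} [Fintype n] [DecidableEq n] {i j : n}
    (hij : i ≠ j) {c t : ℝ} (h : c ^ 2 + t ^ 2 = 1) (m r : ℝ) {d : Fin 2 → ℝ} (hd : ∀ k, 0 ≤ d k) :
    pencil i j m ((projectionHom _ (isStarProjection_vecMulVec hij h) d) ^ r) =
      ((c ^ 2 * d 0 ^ r + t ^ 2 * d 1 ^ r - m ^ 2 * (t ^ 2 * d 0 ^ r + c ^ 2 * d 1 ^ r) : ℝ) : ℂ) := by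
  have hc : (c : ℂ) ^ 2 = 1 - (t : ℂ) ^ 2 := by
    rw [eq_sub_iff_add_eq]; exact_mod_cast h
  rw [rpow_starAlgHom_pi _ hd, projectionHom_apply]
  simp [pencil, Matrix.vecMulVec_apply, hij, hij.symm]
  ring_nf
  rw [hc]
  ring

/-- A nonnegative convex function has a convex zero set. Let `P`, `P'` be the projections onto
`(3/5) e_i ± (4/5) e_j`. For a suitable `m` the function vanishes at both `P + b (1 - P)` and
`P' + b (1 - P')`, hence at their midpoint, which is diagonal; the identity states this vanishing
with `m` eliminated. -/
theorem eq_of_convexOn_pencil {n : Type*} [Fintype n] [DecidableEq n] {i j : n}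
    (hij : i ≠ j) {r s : ℝ} (hs : 0 < s)
    (h : ∀ m : ℝ, ConvexOn ℝ {A : Matrix n n ℂ | A.PosDef}
      (fun A => ‖pencil i j m (A ^ r)‖ ^ (2 * s))) {b : ℝ} (hb : 0 < b) :
    (9 / 25 + 16 / 25 * b ^ r) * (16 / 25 + 9 / 25 * b) ^ r =
      (16 / 25 + 9 / 25 * b ^ r) * (9 / 25 + 16 / 25 * b) ^ r := by
  have h1 : (3 / 5 : ℝ) ^ 2 + (4 / 5) ^ 2 = 1 := by norm_num
  have h2 : (3 / 5 : ℝ) ^ 2 + (-4 / 5) ^ 2 = 1 := by norm_num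
  have hbr := Real.rpow_pos_of_pos hb r
  -- the value of `m ^ 2` for which both non-commuting test matrices are zeros
  set μ := (9 / 25 + 16 / 25 * b ^ r) / (16 / 25 + 9 / 25 * b ^ r) with hμ
  have hμ0 : 0 ≤ μ := by positivity
  have hμe : μ * (16 / 25 + 9 / 25 * b ^ r) = 9 / 25 + 16 / 25 * b ^ r :=
    div_mul_cancel₀ _ (by positivity)
  have hm : √μ ^ 2 = μ := Real.sq_sqrt hμ0
  set d : Fin 2 → ℝ := ![1, b] with hd
  have hdpos : ∀ k, 0 < d k := by
    intro k; fin_cases k <;> simp [hd, hb]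
  have hz : ∀ t : ℝ, (ht : (3 / 5 : ℝ) ^ 2 + t ^ 2 = 1) →
      ‖pencil i j √μ ((projectionHom _ (isStarProjection_vecMulVec hij ht) d) ^ r)‖ ^ (2 * s)
        = 0 := by
    intro t ht
    have ht2 : t ^ 2 = 16 / 25 := by linarith
    rw [pencil_projectionHom_rpow hij ht _ _ fun k => (hdpos k).le, hm, ht2]
    have : (3 / 5 : ℝ) ^ 2 * d 0 ^ r + 16 / 25 * d 1 ^ r -
        μ * (16 / 25 * d 0 ^ r + (3 / 5) ^ 2 * d 1 ^ r) = 0 := by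
      simp only [hd, Matrix.cons_val_zero, Matrix.cons_val_one, Real.one_rpow]
      linarith
    rw [this, Complex.ofReal_zero, norm_zero, Real.zero_rpow (by positivity)]
  set e : n → ℝ := fun k => if k = i then 9 / 25 + 16 / 25 * b else
    if k = j then 16 / 25 + 9 / 25 * b else b with he
  have hepos : ∀ k, 0 < e k := by
    intro k; simp only [he]; split_ifs <;> positivity
  have hmid : (1 / 2 : ℝ) • projectionHom _ (isStarProjection_vecMulVec hij h1) d +
      (1 / 2 : ℝ) • projectionHom _ (isStarProjection_vecMulVec hij h2) d = conjDiagonal 1 e := by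
    rw [projectionHom_apply, projectionHom_apply, conjDiagonal_apply]
    ext k l
    by_cases hki : k = i
    · subst hki
      by_cases hlk : l = k
      · subst hlk
        simp [Matrix.vecMulVec_apply, hij, hd, he]
        ring
      · by_cases hlj : l = j
        · subst hlj
          simp [Matrix.vecMulVec_apply, hij, hij.symm]
          ring
        · simp [Matrix.vecMulVec_apply, hij, hlk, hlj, Ne.symm hlk]
    · by_cases hkj : k = j
      · subst hkj
        by_cases hlk : l = k
        · subst hlk
          simp [Matrix.vecMulVec_apply, hki, hd, he]
          ring
        · by_cases hli : l = i
          · subst hli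
            simp [Matrix.vecMulVec_apply, hij, hij.symm]
            ring
          · simp [Matrix.vecMulVec_apply, hki, hlk, hli, Ne.symm hlk]
      · by_cases hlk : l = k
        · subst hlk
          simp [Matrix.vecMulVec_apply, hki, hkj, hd, he]
          ring
        · simp [Matrix.vecMulVec_apply, hki, hkj, Ne.symm hlk]
  have h3 := (h √μ).2
    (starAlgHom_pi_posDef (projectionHom _ (isStarProjection_vecMulVec hij h1)) hdpos)
    (starAlgHom_pi_posDef (projectionHom _ (isStarProjection_vecMulVec hij h2)) hdpos)
    (by norm_num : (0 : ℝ) ≤ 1 / 2) (by norm_num : (0 : ℝ) ≤ 1 / 2) (by norm_num)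
  simp only [hz _ h1, hz _ h2, smul_zero, add_zero, hmid,
    norm_pencil_conjDiagonal_one_rpow hij _ _ hepos] at h3
  have h4 : e i ^ r - √μ ^ 2 * e j ^ r = 0 := by
    by_contra hne
    exact absurd h3 (not_le.mpr (Real.rpow_pos_of_pos (abs_pos.mpr hne) _))
  have hei : e i = 9 / 25 + 16 / 25 * b := by simp [he]
  have hej : e j = 16 / 25 + 9 / 25 * b := by simp [he, hij.symm]
  rw [hm, hei, hej, sub_eq_zero] at h4
  rw [h4, ← hμe]
  ring

/-- The limit `b → 0` of `eq_of_convexOn_pencil` reads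
`(9/25) (16/25)^r = (16/25) (9/25)^r`, which forces `r = 1`. -/
theorem eq_one_of_convexOn_pencil {n : Type*} [Fintype n] [DecidableEq n] {i j : n}
    (hij : i ≠ j) {r s : ℝ} (hr : 0 < r) (hs : 0 < s)
    (h : ∀ m : ℝ, ConvexOn ℝ {A : Matrix n n ℂ | A.PosDef}
      (fun A => ‖pencil i j m (A ^ r)‖ ^ (2 * s))) : r = 1 := by
  have hlim : ∀ x y : ℝ, Tendsto (fun b : ℝ => (y + x * b ^ r) * (x + y * b) ^ r) (𝓝[>] 0)
      (𝓝 ((y + x * (0 : ℝ) ^ r) * (x + y * 0) ^ r)) := by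
    intro x y
    refine Tendsto.mono_left (ContinuousAt.tendsto ?_) nhdsWithin_le_nhds
    refine ContinuousAt.mul (continuousAt_const.add (continuousAt_const.mul
      (ContinuousAt.rpow_const continuousAt_id (Or.inr hr.le))))
      (ContinuousAt.rpow_const (by fun_prop) (Or.inr hr.le))
  have heq := tendsto_nhds_unique_of_eventuallyEq (hlim (16 / 25) (9 / 25))
    (hlim (9 / 25) (16 / 25)) (by
      filter_upwards [self_mem_nhdsWithin] with b hb using eq_of_convexOn_pencil hij hs h hb)
  rw [Real.zero_rpow hr.ne'] at heq
  simp only [mul_zero, add_zero] at heq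
  have h1 : (16 / 9 : ℝ) ^ r = 16 / 9 := by
    have h2 : (16 / 25 : ℝ) ^ r = (16 / 9) ^ r * (9 / 25) ^ r := by
      rw [← Real.mul_rpow (by norm_num) (by norm_num)]; norm_num
    have h3 : (0 : ℝ) < (9 / 25) ^ r := by positivity
    rw [h2] at heq
    have h4 : ((16 / 9 : ℝ) ^ r - 16 / 9) * (9 / 25) ^ r = 0 := by linarith
    rcases mul_eq_zero.mp h4 with h5 | h5
    · linarith
    · exact absurd h5 h3.ne'
  have h2 : (16 / 9 : ℝ) ^ r = (16 / 9) ^ (1 : ℝ) := by rw [h1, Real.rpow_one]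
  exact (Real.rpow_right_inj (by norm_num) (by norm_num)).mp h2

end

/-! ### The characterization -/

theorem mainTheorem1 (r s : ℝ) (hr : r ≠ 0) (hs : 0 < s) (n : ℕ) (hn : 2 ≤ n) :
    ((∀ K M : Matrix (Fin n) (Fin n) ℂ, IsUnit K → M.PosDef →
        ConvexOn ℝ {A : Matrix (Fin n) (Fin n) ℂ | A.PosDef} (fun A => traceLambda r s K M A)) ↔
      (r = 1 ∧ 1 / 2 ≤ s)) ∧
    ¬ (∀ K M : Matrix (Fin n) (Fin n) ℂ, IsUnit K → M.PosDef →
        ConcaveOn ℝ {A : Matrix (Fin n) (Fin n) ℂ | A.PosDef} (fun A => traceLambda r s K M A)) := by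
  obtain ⟨i, j, hij⟩ : ∃ i j : Fin n, i ≠ j :=
    ⟨⟨0, by omega⟩, ⟨1, by omega⟩, by simp [Fin.ext_iff]⟩
  refine ⟨⟨fun h => ?_, ?_⟩, fun h => ?_⟩
  · have hp : ∀ m : ℝ, ConvexOn ℝ {A : Matrix (Fin n) (Fin n) ℂ | A.PosDef}
        (fun A => ‖pencil i j m (A ^ r)‖ ^ (2 * s)) := by
      intro m
      obtain ⟨K, M, hM, he⟩ := exists_posSemidef_traceLambda_eq r hs i j m
      simpa only [he] using convexOn_traceLambda_of_posSemidef hs h K hM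
    have hd := fun m => convexOn_abs_sub_rpow hij m (hp m)
    have hr0 : 0 < r := lt_of_le_of_ne (nonneg_of_convexOn_abs_sub_rpow hs hij hd) hr.symm
    have hr1 : r = 1 := eq_one_of_convexOn_pencil hij hr0 hs hp
    subst hr1
    refine ⟨rfl, half_le_of_convexOn_abs_sub hs hij ?_⟩
    simpa only [one_pow, one_mul, Real.rpow_one] using hd 1
  · rintro ⟨rfl, hs2⟩ K M hK hM
    exact convexOn_traceLambda_one hK hM hs2
  · obtain ⟨K, M, hM, he⟩ := exists_posSemidef_traceLambda_eq r hs i j 1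
    have hp := concaveOn_traceLambda_of_posSemidef hs h K hM
    simp only [he] at hp
    refine not_concaveOn_abs_sub_rpow hr hs hij ?_
    simpa only [one_pow, one_mul] using concaveOn_abs_sub_rpow hij 1 hp
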